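/- Let $(R,\mathfrak m)$ be a one-dimensional Noetherian local domain with infinite residue field and fraction field $K$. Assume that the integral closure $\overline R$ of $R$ in $K$ is a finite $R$-module and a discrete valuation ring (so $R$ is analytically irreducible), and that $R$ is residually rational, i.e. the map from the residue field of $R$ to that of $\overline R$ is an isomorphism. For $R$-submodules $J,L$ of $K$ put $J:L=\{y\in K\mid yL\subseteq J\}$ and $J^{*}=R:J$; $J$ is reflexive if $J=J^{**}$. Let $\omega$ be a canonical ideal of $R$, i.e. a nonzero fractional ideal with $\omega:(\omega:J)=J$ for every nonzero fractional ideal $J$, normalized so that $R\subseteq\omega\subseteq\overline R$. Assume that $R$ is almost Gorenstein, i.e. $\mathfrak m=\mathfrak m\omega$. Let $I$ be a non-principal $\mathfrak m$-primary ideal of $R$, and let $\Lambda=\bigcup_{n\ge 0}(I^n:I^n)$ be the blowing-up of $R$ along $I$. A minimal reduction of $I$ is an element $x\in I$ such that $I^{n+1}=xI^n$ for all large $n$. Such elements exist. For any minimal reduction $x$ of $I$ let $\nu$ be the reduction exponent, i.e. the least integer $\nu\ge 0$ such that $I^{n+1}=xI^n$ for all $n\ge\nu$. For an ideal $J$ of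 $R$ put $\widetilde J=J\omega\cap R$. Then: (1) The following conditions are all equivalent: - (A$_1$) $\omega\subseteq\Lambda$; (A$_2$) $\omega\Lambda=\Lambda$; (A$_3$) $\omega:\Lambda=R:\Lambda$; (A$_4$) $I^n=\widetilde{I^n}$ for all $n\ge\nu$; (A$_5$) $\omega I^n=I^n$ for all $n\ge\nu$; (A$_6$) $\omega I^n=I^n$ for some $n>0$; - (B$_1$) $\Lambda=\Lambda^{**}$; (B$_2$) $\omega:\Lambda=\omega(R:\Lambda)$; - (C$_1$) $\Lambda\supseteq R:\mathfrak m$; (C$_2$) $I^\nu$ is reflexive; (C$_3$) $I^n$ is reflexive for all $n\ge\nu$; (C$_4$) $I^n$ is reflexive for some $n\ge\nu$. (2) If $I$ is reflexive, then the conditions (A), (B), (C) hold; in particular $\Lambda$ is reflexive. -/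

import Mathlib

open IsLocalRing nonZeroDivisors

namespace CurveSing

/-!
Fractional ideals of the domain `R` are `R`-submodules of its fraction field `K`. For these, `1` is
the copy of `R` in `K`, `*` is the product, and Mathlib's `I / J` is the colon module
`I : J = {x ∈ K | x J ⊆ I}`.
-/

/-- The standing assumptions on the base ring: a one-dimensional Noetherian local domain with
infinite residue field, analytically irreducible (the integral closure in the fraction field is a
finite module and a discrete valuation ring) and residually rational (the map from `R` to the
residue field of the integral closure is onto, that is, `R` and its integral closure have
the same residue field). -/
class IsCurveBranch (R K : Type*) [CommRing R] [IsDomain R] [IsLocalRing R] [Field K] [Algebra R K]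
    [IsFractionRing R K] : Prop where
  noetherian : IsNoetherianRing R
  dim_one : ringKrullDim R = 1
  infinite_residueField : Infinite (ResidueField R)
  finite_integralClosure : Module.Finite R (integralClosure R K)
  dvr_integralClosure : IsDiscreteValuationRing (integralClosure R K)
  residually_rational :
    Function.Surjective ((residue (integralClosure R K)).comp (algebraMap R (integralClosure R K)))

section

variable {R K : Type*} [CommRing R] [IsDomain R] [Field K] [Algebra R K] [IsFractionRing R K]

/-- `ω` is a canonical ideal (Herzog–Kunz): a nonzero fractional ideal with `ω : (ω : J) = J` for
every nonzero fractional ideal `J`. -/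
structure IsCanonicalIdeal (ω : Submodule R K) : Prop where
  ne_bot : ω ≠ ⊥
  isFractional : IsFractional R⁰ ω
  dual_dual : ∀ J : Submodule R K, J ≠ ⊥ → IsFractional R⁰ J → ω / (ω / J) = J

/-- A canonical ideal normalized so that `R ⊆ ω ⊆ R̄`. -/
structure IsNormalizedCanonicalIdeal (ω : Submodule R K) : Prop extends IsCanonicalIdeal ω where
  one_le : 1 ≤ ω
  le_integralClosure : ω ≤ Subalgebra.toSubmodule (integralClosure R K)

variable (K) in
/-- An ideal of `R`, as a submodule of `K`. -/
abbrev toK (I : Ideal R) : Submodule R K := IsLocalization.coeSubmodule K I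

/-- `R` is almost Gorenstein: `m = m ω`, where `ω` is the normalized canonical ideal. -/
def IsAlmostGorenstein [IsLocalRing R] (ω : Submodule R K) : Prop :=
  toK K (maximalIdeal R) = toK K (maximalIdeal R) * ω

/-- The dual `J* = R : J`. -/
def dual (J : Submodule R K) : Submodule R K := 1 / J

/-- `J = J**`. -/
def IsReflexive (J : Submodule R K) : Prop := J = dual (dual J)

/-- The canonical closure `J ω ∩ R`. -/
def canonicalClosure (ω J : Submodule R K) : Submodule R K := J * ω ⊓ 1

theorem pow_div_pow_mono (J : Submodule R K) : Monotone fun n : ℕ => J ^ n / J ^ n := by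
  refine monotone_nat_of_le_succ fun n => ?_
  rw [Submodule.le_div_iff_mul_le, pow_succ, ← mul_assoc]
  have h : J ^ n / J ^ n * J ^ n ≤ J ^ n := Submodule.le_div_iff_mul_le.1 le_rfl
  gcongr

variable (K) in
/-- The blowing-up `Λ(I) = ⋃ₙ (Iⁿ : Iⁿ)` of `R` along `I`. -/
def blowup (I : Ideal R) : Submodule R K where
  carrier := ⋃ n : ℕ, ((toK K I ^ n / toK K I ^ n : Submodule R K) : Set K)
  zero_mem' := Set.mem_iUnion.2 ⟨0, Submodule.zero_mem _⟩
  add_mem' := by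
    intro a b ha hb
    obtain ⟨i, hi⟩ := Set.mem_iUnion.1 ha
    obtain ⟨j, hj⟩ := Set.mem_iUnion.1 hb
    exact Set.mem_iUnion.2 ⟨max i j, Submodule.add_mem _
      (pow_div_pow_mono (toK K I) (le_max_left i j) hi)
      (pow_div_pow_mono (toK K I) (le_max_right i j) hj)⟩
  smul_mem' := by
    intro c a ha
    obtain ⟨i, hi⟩ := Set.mem_iUnion.1 ha
    exact Set.mem_iUnion.2 ⟨i, Submodule.smul_mem _ c hi⟩

end

section

variable {R : Type*} [CommRing R]

/-- `x ∈ I` is a minimal reduction of `I`: `Iⁿ⁺¹ = x Iⁿ` for all large `n`. -/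
def IsMinimalReduction (I : Ideal R) (x : R) : Prop :=
  x ∈ I ∧ ∃ N : ℕ, ∀ n ≥ N, I ^ (n + 1) = Ideal.span {x} * I ^ n

/-- The reduction exponent: the least `ν` with `Iⁿ⁺¹ = x Iⁿ` for all `n ≥ ν`, where `x` is
a minimal reduction of `I`. -/
noncomputable def reductionExponent (I : Ideal R) (x : R) : ℕ :=
  sInf {m : ℕ | ∀ n ≥ m, I ^ (n + 1) = Ideal.span {x} * I ^ n}

end

end CurveSing

/-!
Let `x` be a minimal reduction of `I`. For `n ≥ ν` one has `Λ = Iⁿ : Iⁿ` and `Iⁿ = xⁿ Λ`, with `xⁿ`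
invertible, so the conditions on high powers of `I` are conditions on the overring `Λ`. The
canonical duality `J ↦ ω : J` is injective and sends `ω J` to `R : J`; applying it to `ω Λ = Λ` and
to `Λ** = Λ` yields `ω : Λ = R : Λ` and `ω : Λ = ω (R : Λ)`. If `J` is reflexive but not
invertible, then `J (R : J) ⊆ m`, hence `R : m ⊆ J : J`; as `ω ⊆ R : m` when `R` is almost
Gorenstein, the case `J = Λ` closes the cycle, and the case `J = I` gives (2).

Minimal reductions exist because an element `x` of least value in `I` satisfies `I ⊆ x R̄`, and the
powers of `x⁻¹ I` form an ascending chain in the Noetherian module `R̄`.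
-/

namespace CurveSing

section Colon

variable {R A : Type*} [CommSemiring R] [CommSemiring A] [Algebra R A]

theorem submodule_div_mul_le (J L : Submodule R A) : J / L * L ≤ J :=
  Submodule.le_div_iff_mul_le.1 le_rfl

theorem submodule_div_le_div_left (J : Submodule R A) {L M : Submodule R A} (h : L ≤ M) :
    J / M ≤ J / L :=
  Submodule.le_div_iff_mul_le.2 ((mul_le_mul_right h _).trans (submodule_div_mul_le J M))

theorem submodule_div_le_div_right {J L : Submodule R A} (h : J ≤ L) (M : Submodule R A) :
    J / M ≤ L / M :=
  Submodule.le_div_iff_mul_le.2 ((submodule_div_mul_le J M).trans h)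

theorem submodule_div_one (J : Submodule R A) : J / 1 = J :=
  eq_of_forall_le_iff fun X => by rw [Submodule.le_div_iff_mul_le, mul_one]

theorem submodule_div_div_eq_div_mul (J L M : Submodule R A) : J / L / M = J / (L * M) :=
  eq_of_forall_le_iff fun X => by
    simp only [Submodule.le_div_iff_mul_le, mul_assoc, mul_comm L M]

theorem le_div_div_self (J L : Submodule R A) : L ≤ J / (J / L) :=
  Submodule.le_div_iff_mul_le.2 ((mul_comm _ _).trans_le (submodule_div_mul_le J L))

theorem one_le_div_self (J : Submodule R A) : 1 ≤ J / J :=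
  Submodule.le_div_iff_mul_le.2 (one_mul J).le

theorem div_self_mul_div_self_le (J : Submodule R A) : J / J * (J / J) ≤ J / J := by
  rw [Submodule.le_div_iff_mul_le, mul_assoc]
  exact (mul_le_mul_right (submodule_div_mul_le J J) _).trans (submodule_div_mul_le J J)

theorem div_units_mul (U : (Submodule R A)ˣ) (J L : Submodule R A) :
    J / (U * L) = ↑U⁻¹ * (J / L) := by
  refine eq_of_forall_le_iff fun X => ?_
  have cancel : X ≤ ↑U⁻¹ * (J / L) ↔ U * X ≤ J / L :=
    ⟨fun h => by simpa using mul_le_mul_right h (U : Submodule R A),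
      fun h => by simpa using mul_le_mul_right h (↑U⁻¹ : Submodule R A)⟩
  rw [cancel, Submodule.le_div_iff_mul_le, Submodule.le_div_iff_mul_le, mul_left_comm, mul_assoc]

theorem units_mul_div_units_mul (U : (Submodule R A)ˣ) (J L : Submodule R A) :
    (U * J) / (U * L) = J / L := by
  refine eq_of_forall_le_iff fun X => ?_
  rw [Submodule.le_div_iff_mul_le, Submodule.le_div_iff_mul_le, mul_left_comm]
  exact ⟨fun h => by simpa using mul_le_mul_right h (↑U⁻¹ : Submodule R A),
    fun h => mul_le_mul_right h _⟩

theorem mul_eq_right_iff_le {J L : Submodule R A} (hJ : 1 ≤ J) (hL : 1 ≤ L) (hLL : L * L ≤ L) :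
    J * L = L ↔ J ≤ L := by
  refine ⟨fun h => ?_, fun h => le_antisymm ((mul_le_mul_left h L).trans hLL) ?_⟩
  · calc J = J * 1 := (mul_one J).symm
      _ ≤ J * L := mul_le_mul_right hL J
      _ = L := h
  · calc L = 1 * L := (one_mul L).symm
      _ ≤ J * L := mul_le_mul_left hJ L

end Colon

section StablePowers

variable {R A : Type*} [CommSemiring R] [CommSemiring A] [Algebra R A]
  {J : Submodule R A} {U : (Submodule R A)ˣ} {N : ℕ}

theorem pow_add_eq_units_pow_mul (h : ∀ n ≥ N, J ^ (n + 1) = U * J ^ n) {n : ℕ} (hn : N ≤ n)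
    (k : ℕ) : J ^ (n + k) = ↑(U ^ k) * J ^ n := by
  induction k with
  | zero => simp
  | succ k ih =>
    rw [← add_assoc, h _ (hn.trans (Nat.le_add_right n k)), ih, ← mul_assoc, ← Units.val_mul,
      pow_succ']

theorem pow_div_pow_eq_of_le (h : ∀ n ≥ N, J ^ (n + 1) = U * J ^ n) {n : ℕ} (hn : N ≤ n) :
    J ^ n / J ^ n = J ^ N / J ^ N := by
  obtain ⟨k, rfl⟩ := Nat.exists_eq_add_of_le hn
  rw [pow_add_eq_units_pow_mul h le_rfl, units_mul_div_units_mul]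

theorem units_pow_mul_pow_div_pow (hU : U ≤ J) (h : ∀ n ≥ N, J ^ (n + 1) = U * J ^ n) {n : ℕ}
    (hn : N ≤ n) : ↑(U ^ n) * (J ^ n / J ^ n) = J ^ n := by
  apply le_antisymm
  · calc ↑(U ^ n) * (J ^ n / J ^ n) ≤ J ^ n * (J ^ n / J ^ n) := by
          rw [Units.val_pow_eq_pow_val]
          gcongr
      _ = J ^ n / J ^ n * J ^ n := mul_comm _ _
      _ ≤ J ^ n := submodule_div_mul_le _ _
  · have hdiv : ↑(U ^ n)⁻¹ * J ^ n ≤ J ^ n / J ^ n := by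
      rw [Submodule.le_div_iff_mul_le, mul_assoc, ← pow_add, pow_add_eq_units_pow_mul h hn,
        Units.inv_mul_cancel_left]
    simpa only [Units.mul_inv_cancel_left] using mul_le_mul_right hdiv (↑(U ^ n) : Submodule R A)

end StablePowers

section FractionalIdeals

variable {R K : Type*} [CommRing R] [Field K] [Algebra R K]

theorem toK_pow (I : Ideal R) (n : ℕ) : toK K (I ^ n) = toK K I ^ n :=
  Submodule.map_pow (M := I) (Algebra.ofId R K) n

theorem toK_le_one (I : Ideal R) : toK K I ≤ 1 :=
  (IsLocalization.coeSubmodule_mono K le_top).trans_eq (IsLocalization.coeSubmodule_top K)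

theorem le_toK_maximalIdeal [IsLocalRing R] {J : Submodule R K} (hJ : J ≤ 1) (hJ' : J ≠ 1) :
    J ≤ toK K (maximalIdeal R) := by
  obtain ⟨I, rfl⟩ : ∃ I : Ideal R, toK K I = J :=
    ⟨J.comap (Algebra.linearMap R K),
      Submodule.map_comap_eq_self (hJ.trans_eq Submodule.one_eq_range)⟩
  refine IsLocalization.coeSubmodule_mono K (le_maximalIdeal ?_)
  rintro rfl
  exact hJ' (IsLocalization.coeSubmodule_top K)

theorem toK_pow_le_toK_maximalIdeal [IsLocalRing R] {I : Ideal R} (hI : I ≠ ⊤) {n : ℕ}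
    (hn : n ≠ 0) : toK K I ^ n ≤ toK K (maximalIdeal R) := by
  rw [← toK_pow]
  exact IsLocalization.coeSubmodule_mono K ((Ideal.pow_le_self hn).trans (le_maximalIdeal hI))

variable [IsFractionRing R K]

theorem isPrincipal_of_isUnit [IsLocalRing R] {J : Submodule R K} (hJ : IsUnit J) :
    J.IsPrincipal := by
  have hfinite : {I : Ideal R | I.IsMaximal}.Finite :=
    (Set.finite_singleton (maximalIdeal R)).subset fun _ => eq_maximalIdeal
  obtain ⟨U, rfl⟩ := hJ
  let V := (FractionalIdeal.unitsMulEquivSubmodule (S := R⁰) (R := R) (P := K)).symm U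
  exact FractionalIdeal.isPrincipal.of_finite_maximals_of_inv le_rfl hfinite V.val V⁻¹.val V.mul_inv

theorem isUnit_toK_span_singleton {x : R} (hx : x ≠ 0) : IsUnit (toK K (Ideal.span {x})) := by
  have hx' : IsUnit (algebraMap R K x) := by simpa using hx
  rw [toK, IsLocalization.coeSubmodule_span_singleton]
  exact hx'.map (Submodule.spanSingleton R)

theorem div_ne_bot [IsDomain R] {J L : Submodule R K} (hJ : J ≠ ⊥) (hL : IsFractional R⁰ L) :
    J / L ≠ ⊥ := by
  obtain ⟨d, hd, hdL⟩ := hL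
  obtain ⟨y, hyJ, hy⟩ := Submodule.exists_mem_ne_zero_of_ne_bot hJ
  have hdy : d • y ≠ 0 := by
    rw [Algebra.smul_def]
    exact mul_ne_zero (by simpa using nonZeroDivisors.ne_zero hd) hy
  refine (Submodule.ne_bot_iff _).2 ⟨d • y, fun z hz => ?_, hdy⟩
  obtain ⟨r, hr⟩ := hdL z hz
  have hmul : d • y * z = r • y := by
    rw [smul_mul_assoc, ← mul_smul_comm, ← hr, mul_comm, ← Algebra.smul_def]
  exact hmul ▸ J.smul_mem r hyJ

end FractionalIdeals

section MinimalReduction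

variable {R : Type*} [CommRing R] {I : Ideal R} {x : R}

theorem IsMinimalReduction.span_singleton_le (hx : IsMinimalReduction I x) : Ideal.span {x} ≤ I :=
  (Ideal.span_singleton_le_iff_mem I).2 hx.1

theorem IsMinimalReduction.pow_succ_eq (hx : IsMinimalReduction I x) {n : ℕ}
    (hn : reductionExponent I x ≤ n) : I ^ (n + 1) = Ideal.span {x} * I ^ n :=
  Nat.sInf_mem (s := {m : ℕ | ∀ n ≥ m, I ^ (n + 1) = Ideal.span {x} * I ^ n}) hx.2 n hn

theorem IsMinimalReduction.reductionExponent_pos (hx : IsMinimalReduction I x)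
    (hI : ¬ I.IsPrincipal) : 0 < reductionExponent I x := by
  refine Nat.pos_of_ne_zero fun h => hI ⟨⟨x, ?_⟩⟩
  simpa using hx.pow_succ_eq h.le

theorem IsMinimalReduction.ne_zero [IsReduced R] (hx : IsMinimalReduction I x) (hI : I ≠ ⊥) :
    x ≠ 0 := by
  rintro rfl
  have h : I ^ (reductionExponent I 0 + 1) = 0 := by simpa using hx.pow_succ_eq le_rfl
  exact hI (pow_eq_zero_iff (Nat.succ_ne_zero _) |>.1 h)

theorem IsMinimalReduction.toK_pow_succ_eq {K : Type*} [Field K] [Algebra R K]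
    (hx : IsMinimalReduction I x) {n : ℕ} (hn : reductionExponent I x ≤ n) :
    toK K I ^ (n + 1) = toK K (Ideal.span {x}) * toK K I ^ n := by
  rw [← toK_pow, hx.pow_succ_eq hn, toK, IsLocalization.coeSubmodule_mul, ← toK, ← toK, toK_pow]

end MinimalReduction

section Blowup

variable {R K : Type*} [CommRing R] [IsDomain R] [Field K] [Algebra R K] [IsFractionRing R K]
  {I : Ideal R} {x : R}

theorem mem_blowup {z : K} : z ∈ blowup K I ↔ ∃ n : ℕ, z ∈ toK K I ^ n / toK K I ^ n :=
  Set.mem_iUnion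

theorem pow_div_pow_le_blowup (I : Ideal R) (n : ℕ) : toK K I ^ n / toK K I ^ n ≤ blowup K I :=
  fun _ hz => mem_blowup.2 ⟨n, hz⟩

theorem one_le_blowup (I : Ideal R) : 1 ≤ blowup K I :=
  (one_le_div_self _).trans (pow_div_pow_le_blowup I 0)

namespace IsMinimalReduction

theorem blowup_eq (hx : IsMinimalReduction I x) (hI : I ≠ ⊥) {n : ℕ}
    (hn : reductionExponent I x ≤ n) : blowup K I = toK K I ^ n / toK K I ^ n := by
  obtain ⟨U, hU⟩ := isUnit_toK_span_singleton (K := K) (hx.ne_zero hI)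
  refine le_antisymm (fun z hz => ?_) (pow_div_pow_le_blowup I n)
  obtain ⟨m, hm⟩ := mem_blowup.1 hz
  rw [← pow_div_pow_eq_of_le (fun k hk => hU ▸ hx.toK_pow_succ_eq (hn.trans hk))
    (le_max_right m n)]
  exact pow_div_pow_mono (toK K I) (le_max_left m n) hm

theorem toK_pow_eq (hx : IsMinimalReduction I x) (hI : I ≠ ⊥) {n : ℕ}
    (hn : reductionExponent I x ≤ n) :
    toK K I ^ n = toK K (Ideal.span {x}) ^ n * blowup K I := by
  obtain ⟨U, hU⟩ := isUnit_toK_span_singleton (K := K) (hx.ne_zero hI)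
  have hUI : U ≤ toK K I := hU ▸ IsLocalization.coeSubmodule_mono K hx.span_singleton_le
  rw [hx.blowup_eq hI hn, ← hU, ← Units.val_pow_eq_pow_val,
    units_pow_mul_pow_div_pow hUI (fun k hk => hU ▸ hx.toK_pow_succ_eq hk) hn]

theorem blowup_mul_blowup_le (hx : IsMinimalReduction I x) (hI : I ≠ ⊥) :
    blowup K I * blowup K I ≤ blowup K I := by
  rw [hx.blowup_eq hI le_rfl]
  exact div_self_mul_div_self_le _

theorem isFractional_blowup (hx : IsMinimalReduction I x) (hI : I ≠ ⊥) :
    IsFractional R⁰ (blowup K I) := by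
  have hfrac : IsFractional R⁰ (toK K (I ^ reductionExponent I x)) :=
    FractionalIdeal.isFractional_of_le_one _ (toK_le_one _)
  rw [hx.blowup_eq hI le_rfl, ← toK_pow]
  refine hfrac.div_of_nonzero hfrac ?_
  rw [toK_pow]
  refine pow_ne_zero _ fun h => hI ?_
  exact IsFractionRing.coeSubmodule_injective R K
    (h.trans (IsLocalization.coeSubmodule_bot K).symm)

theorem blowup_ne_one (hx : IsMinimalReduction I x) (hI : I ≠ ⊥) (hI' : ¬ I.IsPrincipal) :
    blowup K I ≠ 1 := by
  intro hΛ
  obtain ⟨U, hU⟩ := isUnit_toK_span_singleton (K := K) (hx.ne_zero hI)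
  have hdiv : ↑U⁻¹ * toK K I ≤ 1 := by
    rw [← hΛ, hx.blowup_eq hI le_rfl, Submodule.le_div_iff_mul_le, mul_assoc, ← pow_succ',
      hx.toK_pow_succ_eq le_rfl, ← hU, Units.inv_mul_cancel_left]
  have hle : toK K I ≤ toK K (Ideal.span {x}) := by
    rw [← hU]
    simpa only [Units.mul_inv_cancel_left, mul_one] using
      mul_le_mul_right hdiv (U : Submodule R K)
  exact hI' ⟨⟨x, (IsFractionRing.coeSubmodule_le_coeSubmodule.1 hle).antisymm
    hx.span_singleton_le⟩⟩

end IsMinimalReduction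

end Blowup

section Existence

theorem exists_mem_forall_dvd {V : Type*} [CommRing V] [IsNoetherianRing V] [PreValuationRing V]
    {s : Set V} (hs : s.Nonempty) : ∃ x ∈ s, ∀ y ∈ s, x ∣ y := by
  obtain ⟨x, hx, hmax⟩ :=
    exists_maximalFor_of_wellFoundedGT (· ∈ s) (fun y => Ideal.span {y}) hs
  refine ⟨x, hx, fun y hy => (ValuationRing.dvd_total x y).elim id fun hyx => ?_⟩
  exact Ideal.span_singleton_le_span_singleton.1
    (hmax hy (Ideal.span_singleton_le_span_singleton.2 hyx))

theorem exists_forall_pow_succ_eq_pow {R A : Type*} [CommSemiring R] [CommSemiring A] [Algebra R A]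
    {M : Submodule R A} (hM : 1 ≤ M) (V : Subalgebra R A) [IsNoetherian R V]
    (hMV : M ≤ Subalgebra.toSubmodule V) : ∃ N, ∀ n ≥ N, M ^ (n + 1) = M ^ n := by
  have hpow (n : ℕ) : M ^ n ≤ Subalgebra.toSubmodule V := by
    induction n with
    | zero => exact (pow_zero M).trans_le (Submodule.one_le.2 (one_mem V))
    | succ n ih =>
      rw [pow_succ]
      exact (mul_le_mul' ih hMV).trans_eq V.isIdempotentElem_toSubmodule
  have : WellFoundedGT (Set.Iic (Subalgebra.toSubmodule V)) :=
    (Submodule.mapIic (Subalgebra.toSubmodule V)).symm.toOrderEmbedding.wellFoundedGT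
  obtain ⟨N, hN⟩ := WellFoundedGT.monotone_chain_condition
    (⟨fun n => ⟨M ^ n, hpow n⟩, pow_right_monotone hM⟩ : ℕ →o Set.Iic (Subalgebra.toSubmodule V))
  refine ⟨N, fun n hn => ?_⟩
  have h := (hN (n + 1) (hn.trans n.le_succ)).symm.trans (hN n hn)
  exact congrArg Subtype.val h

variable {R K : Type*} [CommRing R] [Field K] [Algebra R K] [IsFractionRing R K] {I : Ideal R}

theorem isMinimalReduction_of_le_mul (V : Subalgebra R K) [IsNoetherian R V] {x : R} (hx : x ∈ I)
    (hx0 : x ≠ 0) (hV : toK K I ≤ toK K (Ideal.span {x}) * Subalgebra.toSubmodule V) :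
    IsMinimalReduction I x := by
  obtain ⟨U, hU⟩ := isUnit_toK_span_singleton (K := K) hx0
  set M := ↑U⁻¹ * toK K I with hM
  have hpow (k : ℕ) : toK K I ^ k = (U : Submodule R K) ^ k * M ^ k := by
    rw [← mul_pow, hM, Units.mul_inv_cancel_left]
  have hM1 : 1 ≤ M := by
    rw [hM, ← U.inv_mul, hU]
    exact mul_le_mul_right (IsLocalization.coeSubmodule_mono K
      ((Ideal.span_singleton_le_iff_mem I).2 hx)) _
  have hMV : M ≤ Subalgebra.toSubmodule V := by
    simpa only [← hU, Units.inv_mul_cancel_left] using mul_le_mul_right hV (↑U⁻¹ : Submodule R K)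
  obtain ⟨N, hN⟩ := exists_forall_pow_succ_eq_pow hM1 V hMV
  refine ⟨hx, N, fun n hn => IsFractionRing.coeSubmodule_injective R K ?_⟩
  rw [IsLocalization.coeSubmodule_mul, ← toK, ← toK, ← toK, toK_pow, toK_pow, ← hU, hpow, hpow,
    hN n hn, pow_succ', mul_assoc]

theorem exists_isMinimalReduction (V : Subalgebra R K) [IsNoetherian R V] [PreValuationRing V]
    (hI : I ≠ ⊥) : ∃ x : R, IsMinimalReduction I x := by
  have : IsNoetherianRing V := isNoetherian_of_tower R ‹_›
  obtain ⟨-, ⟨x, hx, rfl⟩, hdvd⟩ :=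
    exists_mem_forall_dvd (I.nonempty.image (algebraMap R V))
  have hx0 : x ≠ 0 := by
    rintro rfl
    refine hI ((Submodule.eq_bot_iff I).2 fun y hy => ?_)
    have hy0 : algebraMap R V y = 0 := by simpa using hdvd _ ⟨y, hy, rfl⟩
    exact IsFractionRing.injective R K ((congrArg V.val hy0).trans (map_zero _).symm)
  refine ⟨x, isMinimalReduction_of_le_mul V hx hx0 ?_⟩
  rintro - ⟨y, hy, rfl⟩
  obtain ⟨c, hc⟩ := hdvd _ ⟨y, hy, rfl⟩
  have hyx : algebraMap R K y = algebraMap R K x * c := congrArg Subtype.val hc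
  rw [Algebra.linearMap_apply, hyx]
  exact Submodule.mul_mem_mul ⟨x, Ideal.mem_span_singleton_self x, rfl⟩ c.2

end Existence

section Canonical

variable {R K : Type*} [CommRing R] [Field K] [Algebra R K]
  {ω J L : Submodule R K}

namespace IsCanonicalIdeal

theorem div_self (hω : IsCanonicalIdeal ω) : ω / ω = 1 := by
  simpa only [submodule_div_one] using
    hω.dual_dual 1 one_ne_zero (FractionalIdeal.isFractional_of_le_one 1 le_rfl)

theorem div_mul_eq (hω : IsCanonicalIdeal ω) (J : Submodule R K) : ω / (ω * J) = 1 / J := by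
  rw [← submodule_div_div_eq_div_mul, hω.div_self]

theorem div_right_inj (hω : IsCanonicalIdeal ω) (hJ : J ≠ ⊥) (hJ' : IsFractional R⁰ J)
    (hL : L ≠ ⊥) (hL' : IsFractional R⁰ L) : ω / J = ω / L ↔ J = L := by
  refine ⟨fun h => ?_, fun h => h ▸ rfl⟩
  rw [← hω.dual_dual J hJ hJ', h, hω.dual_dual L hL hL']

theorem mul_eq_self_iff (hω : IsCanonicalIdeal ω) (hJ : J ≠ ⊥) (hJ' : IsFractional R⁰ J) :
    ω * J = J ↔ ω / J = 1 / J := by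
  rw [← hω.div_right_inj (mul_ne_zero hω.ne_bot hJ) (hω.isFractional.mul hJ') hJ hJ',
    hω.div_mul_eq, eq_comm]

theorem isReflexive_iff [IsDomain R] [IsFractionRing R K] (hω : IsCanonicalIdeal ω) (hJ : J ≠ ⊥)
    (hJ' : IsFractional R⁰ J) :
    IsReflexive J ↔ ω / J = ω * (1 / J) := by
  have hone : IsFractional R⁰ (1 : Submodule R K) :=
    FractionalIdeal.isFractional_of_le_one 1 le_rfl
  rw [← hω.div_right_inj (div_ne_bot hω.ne_bot hJ') (hω.isFractional.div_of_nonzero hJ' hJ)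
    (mul_ne_zero hω.ne_bot (div_ne_bot one_ne_zero hJ'))
    (hω.isFractional.mul (hone.div_of_nonzero hJ' hJ)),
    hω.dual_dual J hJ hJ', hω.div_mul_eq]
  rfl

end IsCanonicalIdeal
end Canonical

section Reflexive

variable {R K : Type*} [CommRing R] [Field K] [Algebra R K]

theorem isReflexive_units_mul_iff (U : (Submodule R K)ˣ) (J : Submodule R K) :
    IsReflexive ((U : Submodule R K) * J) ↔ IsReflexive J := by
  rw [IsReflexive, IsReflexive, dual, dual, dual, dual, div_units_mul, div_units_mul, inv_inv,
    Units.mul_right_inj]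

theorem IsReflexive.dual_maximalIdeal_le_div_self [IsLocalRing R] {J : Submodule R K}
    (hJ : IsReflexive J) (hJ' : ¬ IsUnit J) : 1 / toK K (maximalIdeal R) ≤ J / J := by
  have hm : J * (1 / J) ≤ toK K (maximalIdeal R) :=
    le_toK_maximalIdeal Submodule.mul_one_div_le_one fun h => hJ' (IsUnit.of_mul_eq_one _ h)
  rw [Submodule.le_div_iff_mul_le]
  conv_rhs => rw [hJ, dual, dual]
  rw [Submodule.le_div_iff_mul_le, mul_assoc]
  exact (mul_le_mul_right hm _).trans (submodule_div_mul_le _ _)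

end Reflexive

section AlmostGorenstein

variable {R K : Type*} [CommRing R] [IsLocalRing R] [Field K] [Algebra R K]
  {ω : Submodule R K}

namespace IsAlmostGorenstein

theorem le_dual_maximalIdeal (hR : IsAlmostGorenstein ω) : ω ≤ 1 / toK K (maximalIdeal R) := by
  rw [Submodule.le_div_iff_mul_le, mul_comm, ← hR]
  exact toK_le_one _

theorem canonicalClosure_eq (hR : IsAlmostGorenstein ω) {J : Submodule R K}
    (hJ : J ≤ toK K (maximalIdeal R)) : canonicalClosure ω J = J * ω :=
  inf_eq_left.2 ((mul_le_mul_left hJ ω).trans (hR.symm.le.trans (toK_le_one _)))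

theorem tfae_le_overring [IsDomain R] [IsFractionRing R K] (hR : IsAlmostGorenstein ω)
    (hω : IsCanonicalIdeal ω) (hω1 : 1 ≤ ω) {Λ : Submodule R K} (hΛ : IsFractional R⁰ Λ)
    (hΛ1 : 1 ≤ Λ) (hΛΛ : Λ * Λ ≤ Λ) (hΛR : Λ ≠ 1) :
    List.TFAE [
      ω ≤ Λ,
      ω * Λ = Λ,
      ω / Λ = 1 / Λ,
      IsReflexive Λ,
      ω / Λ = ω * (1 / Λ),
      1 / toK K (maximalIdeal R) ≤ Λ] := by
  have hΛ0 : Λ ≠ ⊥ := fun h => one_ne_zero (le_bot_iff.1 (h ▸ hΛ1))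
  have hΛU : ¬ IsUnit Λ := fun h => hΛR <| (IsIdempotentElem.iff_eq_one_of_isUnit h).1 <|
    (mul_eq_right_iff_le hΛ1 hΛ1 hΛΛ).2 le_rfl
  have hΛdiv : Λ / Λ = Λ := by
    refine le_antisymm ?_ (Submodule.le_div_iff_mul_le.2 hΛΛ)
    exact (submodule_div_le_div_left Λ hΛ1).trans_eq (submodule_div_one Λ)
  tfae_have 1 ↔ 2 := (mul_eq_right_iff_le hω1 hΛ1 hΛΛ).symm
  tfae_have 2 ↔ 3 := hω.mul_eq_self_iff hΛ0 hΛ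
  tfae_have 3 → 4 := fun h => by
    refine (le_div_div_self 1 Λ).antisymm ?_
    conv_rhs => rw [← hω.dual_dual Λ hΛ0 hΛ, h]
    exact submodule_div_le_div_right hω1 _
  tfae_have 4 ↔ 5 := hω.isReflexive_iff hΛ0 hΛ
  tfae_have 4 → 6 := fun h => (h.dual_maximalIdeal_le_div_self hΛU).trans_eq hΛdiv
  tfae_have 6 → 1 := hR.le_dual_maximalIdeal.trans
  tfae_finish

end IsAlmostGorenstein
end AlmostGorenstein

section Main

variable {R K : Type*} [CommRing R] [IsDomain R] [Field K] [Algebra R K] [IsFractionRing R K]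
  {I : Ideal R} {x : R} {n : ℕ}

namespace IsMinimalReduction

theorem mul_toK_pow_eq_iff (hx : IsMinimalReduction I x) (hI : I ≠ ⊥)
    (hn : reductionExponent I x ≤ n) (J : Submodule R K) :
    J * toK K I ^ n = toK K I ^ n ↔ J * blowup K I = blowup K I := by
  obtain ⟨U, hU⟩ := isUnit_toK_span_singleton (K := K) (hx.ne_zero hI)
  rw [hx.toK_pow_eq hI hn, ← hU, ← Units.val_pow_eq_pow_val, mul_left_comm, Units.mul_right_inj]

theorem isReflexive_toK_pow_iff (hx : IsMinimalReduction I x) (hI : I ≠ ⊥)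
    (hn : reductionExponent I x ≤ n) :
    IsReflexive (toK K I ^ n) ↔ IsReflexive (blowup K I) := by
  obtain ⟨U, hU⟩ := isUnit_toK_span_singleton (K := K) (hx.ne_zero hI)
  rw [hx.toK_pow_eq hI hn, ← hU, ← Units.val_pow_eq_pow_val, isReflexive_units_mul_iff]

end IsMinimalReduction

theorem le_blowup_of_mul_pow_eq {J : Submodule R K} (h : J * toK K I ^ n = toK K I ^ n) :
    J ≤ blowup K I :=
  (Submodule.le_div_iff_mul_le.2 h.le).trans (pow_div_pow_le_blowup I n)

theorem IsCurveBranch.exists_isMinimalReduction [IsLocalRing R] [IsCurveBranch R K] (hI : I ≠ ⊥) :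
    ∃ x : R, IsMinimalReduction I x := by
  have := IsCurveBranch.noetherian (R := R) (K := K)
  have := IsCurveBranch.finite_integralClosure (R := R) (K := K)
  have := IsCurveBranch.dvr_integralClosure (R := R) (K := K)
  exact CurveSing.exists_isMinimalReduction (integralClosure R K) hI

end Main

end CurveSing

open CurveSing IsLocalRing in
theorem theorem5p10_general {R K : Type*} [CommRing R] [IsDomain R] [IsLocalRing R]
    [Field K] [Algebra R K] [IsFractionRing R K]
    {ω : Submodule R K} (hω : IsCanonicalIdeal ω) (hω1 : 1 ≤ ω) (hR : IsAlmostGorenstein ω)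
    {I : Ideal R} (hI : ¬ I.IsPrincipal) {x : R} (hx : IsMinimalReduction I x) :
    List.TFAE [
      ω ≤ blowup K I,
      ω * blowup K I = blowup K I,
      ω / blowup K I = 1 / blowup K I,
      ∀ n ≥ reductionExponent I x, toK K I ^ n = canonicalClosure ω (toK K I ^ n),
      ∀ n ≥ reductionExponent I x, ω * toK K I ^ n = toK K I ^ n,
      ∃ n > 0, ω * toK K I ^ n = toK K I ^ n,
      IsReflexive (blowup K I),
      ω / blowup K I = ω * (1 / blowup K I),
      1 / toK K (maximalIdeal R) ≤ blowup K I,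
      IsReflexive (toK K I ^ reductionExponent I x),
      ∀ n ≥ reductionExponent I x, IsReflexive (toK K I ^ n),
      ∃ n ≥ reductionExponent I x, IsReflexive (toK K I ^ n)] ∧
    (IsReflexive (toK K I) →
      ω ≤ blowup K I ∧ IsReflexive (blowup K I) ∧
        1 / toK K (maximalIdeal R) ≤ blowup K I) := by
  have hI0 : I ≠ ⊥ := fun h => hI (h ▸ inferInstance)
  have hI1 : I ≠ ⊤ := fun h => hI (h ▸ inferInstance)
  have hν := hx.reductionExponent_pos hI
  have hΛ := hR.tfae_le_overring hω hω1 (hx.isFractional_blowup hI0) (one_le_blowup I)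
    (hx.blowup_mul_blowup_le hI0) (hx.blowup_ne_one hI0 hI)
  refine ⟨?_, fun hrefl => ?_⟩
  · tfae_have 1 ↔ 2 := hΛ.out 0 1
    tfae_have 1 ↔ 3 := hΛ.out 0 2
    tfae_have 1 ↔ 7 := hΛ.out 0 3
    tfae_have 1 ↔ 8 := hΛ.out 0 4
    tfae_have 1 ↔ 9 := hΛ.out 0 5
    tfae_have 4 ↔ 5 := forall₂_congr fun n hn => by
      rw [hR.canonicalClosure_eq (toK_pow_le_toK_maximalIdeal hI1 (hν.trans_le hn).ne'), mul_comm,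
        eq_comm]
    tfae_have 2 → 5 := fun h n hn => (hx.mul_toK_pow_eq_iff hI0 hn ω).2 h
    tfae_have 5 → 6 := fun h => ⟨_, hν, h _ le_rfl⟩
    tfae_have 6 → 1 := fun ⟨n, _, h⟩ => le_blowup_of_mul_pow_eq h
    tfae_have 7 → 11 := fun h n hn => (hx.isReflexive_toK_pow_iff hI0 hn).2 h
    tfae_have 11 → 10 := fun h => h _ le_rfl
    tfae_have 10 → 12 := fun h => ⟨_, le_rfl, h⟩
    tfae_have 12 → 7 := fun ⟨n, hn, h⟩ => (hx.isReflexive_toK_pow_iff hI0 hn).1 h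
    tfae_finish
  · have hunit : ¬ IsUnit (toK K I) := fun h =>
      hI ((IsFractionRing.coeSubmodule_isPrincipal R K).1 (isPrincipal_of_isUnit h))
    have hC : 1 / toK K (maximalIdeal R) ≤ blowup K I :=
      (hrefl.dual_maximalIdeal_le_div_self hunit).trans <| by
        simpa only [pow_one] using pow_div_pow_le_blowup I 1
    exact ⟨(hΛ.out 5 0).1 hC, (hΛ.out 5 3).1 hC, hC⟩

open CurveSing in
theorem theorem5p10 {R K : Type*} [CommRing R] [IsDomain R] [IsLocalRing R]
    [Field K] [Algebra R K] [IsFractionRing R K] [IsCurveBranch R K]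
    (ω : Submodule R K) (hω : IsNormalizedCanonicalIdeal ω) (hR : IsAlmostGorenstein ω)
    (I : Ideal R) (hI : I.radical = IsLocalRing.maximalIdeal R)
    (hI' : ¬ Submodule.IsPrincipal I) :
    -- minimal reductions of `I` exist, and for the reduction exponent given by any of them
    -- the conditions (A), (B), (C) are equivalent
    (∃ x : R, IsMinimalReduction I x) ∧
    (∀ x : R, IsMinimalReduction I x →
      List.TFAE [
        -- (A)
        ω ≤ blowup K I,
        ω * blowup K I = blowup K I,
        ω / blowup K I = 1 / blowup K I,
        ∀ n ≥ reductionExponent I x, toK K I ^ n = canonicalClosure ω (toK K I ^ n),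
        ∀ n ≥ reductionExponent I x, ω * toK K I ^ n = toK K I ^ n,
        ∃ n > 0, ω * toK K I ^ n = toK K I ^ n,
        -- (B)
        IsReflexive (blowup K I),
        ω / blowup K I = ω * (1 / blowup K I),
        -- (C)
        1 / toK K (IsLocalRing.maximalIdeal R) ≤ blowup K I,
        IsReflexive (toK K I ^ reductionExponent I x),
        ∀ n ≥ reductionExponent I x, IsReflexive (toK K I ^ n),
        ∃ n ≥ reductionExponent I x, IsReflexive (toK K I ^ n)]) ∧
    -- if `I` is reflexive, then (A), (B), (C) hold; in particular `Λ` is reflexive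
    (IsReflexive (toK K I) →
      ω ≤ blowup K I ∧ IsReflexive (blowup K I) ∧
        1 / toK K (IsLocalRing.maximalIdeal R) ≤ blowup K I) := by
  obtain ⟨x₀, hx₀⟩ := IsCurveBranch.exists_isMinimalReduction (K := K) (I := I)
    fun h => hI' (h ▸ inferInstance)
  exact ⟨⟨x₀, hx₀⟩, fun x hx => (theorem5p10_general hω.1 hω.one_le hR hI' hx).1,
    (theorem5p10_general hω.1 hω.one_le hR hI' hx₀).2⟩
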